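/- Let $q$ be an odd prime power and let $G\le\mathrm{AGL}(2,q)$ be the group of all permutations $v\mapsto Av+b$ of $\Omega=\mathbb F_q^2$, where $b\in\mathbb F_q^2$ and $A$ runs over all monomial $2\times 2$ matrices over $\mathbb F_q$ (exactly one nonzero entry in each row and each column) with $\det A=\pm1$. Let $\mathcal X=\mathrm{Inv}(G)$ be the Passman scheme of degree $q^2$, i.e. the coherent configuration on $\Omega$ whose basis relations are the orbits of $G$ on $\Omega\times\Omega$. For $\alpha_1,\dots,\alpha_m\in\Omega$, let the point extension $\mathcal X_{\alpha_1,\dots,\alpha_m}$ be the smallest (coarsest) coherent configuration on $\Omega$ for which every basis relation of $\mathcal X$ and each of the relations $\{(\alpha_i,\alpha_i)\}$ is a union of basis relations. Then, for every set $\{\alpha_1,\dots,\alpha_m\}$ of at least two distinct points of $\Omega$, the coherent configuration $\mathcal X_{\alpha_1,\dots,\alpha_m}$ is partly regular: there is a point $\alpha\in\Omega$ such that for every basis relation $s$ of $\mathcal X_{\alpha_1,\dots,\alpha_m}$ there is at most one $\beta\in\Omega$ with $(\alpha,\beta)\in s$. Here a coherent configuration on a finite set $\Omega$ is a partition $S$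 of $\Omega\times\Omega$ (its members are the basis relations) such that the diagonal is a union of members of $S$, the converse $s^*=\{(\beta,\alpha):(\alpha,\beta)\in s\}$ of every $s\in S$ belongs to $S$, and for all $r,s,t\in S$ the number of $\gamma\in\Omega$ with $(\alpha,\gamma)\in r$ and $(\gamma,\beta)\in s$ does not depend on the choice of $(\alpha,\beta)\in t$. -/

import Mathlib

/-! Binary relations on `Ω` are subsets of `Ω × Ω`. -/

/-- The converse relation `r* = {(β, α) : (α, β) ∈ r}`. -/
def conv {Ω : Type*} (r : Set (Ω × Ω)) : Set (Ω × Ω) := {p | (p.2, p.1) ∈ r}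

/-- The neighbourhood `α r = {β : (α, β) ∈ r}`. -/
def nbhd {Ω : Type*} (α : Ω) (r : Set (Ω × Ω)) : Set Ω := {β | (α, β) ∈ r}

/-- `S^∪`: the set of all unions of members of `S`. -/
def unions {P : Type*} (S : Set (Set P)) : Set (Set P) := {r | ∃ U ⊆ S, r = ⋃₀ U}

/-- A rainbow on `Ω`: a partition of `Ω × Ω` for which the diagonal is a union of classes and
which is closed under taking converses. -/
structure Rainbow (Ω : Type*) [Finite Ω] where
  /-- the set of basis relations -/
  basis : Set (Set (Ω × Ω))
  isPartition : Setoid.IsPartition basis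
  diagonal_mem : Set.diagonal Ω ∈ unions basis
  conv_basis : conv '' basis = basis

/-- A coherent configuration: a rainbow such that for basis relations `r`, `s`, `t` the number
`|α r ∩ β s*|` does not depend on the choice of `(α, β) ∈ t`. -/
structure CoherentConfiguration (Ω : Type*) [Finite Ω] extends Rainbow Ω where
  coherent : ∀ r ∈ basis, ∀ s ∈ basis, ∀ t ∈ basis, ∀ p ∈ t, ∀ p' ∈ t,
    (nbhd p.1 r ∩ nbhd p.2 (conv s)).ncard = (nbhd p'.1 r ∩ nbhd p'.2 (conv s)).ncard

theorem mem_unions_classes {P : Type*} (c : Setoid P) (r : Set P) :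
    r ∈ unions c.classes ↔ ∀ p p', c p p' → p ∈ r → p' ∈ r := by
  constructor
  · rintro ⟨U, hU, rfl⟩ p p' h ⟨u, hu, hp⟩
    obtain ⟨z, rfl⟩ := hU hu
    exact ⟨_, hu, c.trans (c.symm h) hp⟩
  · intro h
    refine ⟨{u | u ∈ c.classes ∧ u ⊆ r}, fun u hu => hu.1, ?_⟩
    ext p
    constructor
    · intro hp
      exact ⟨{x | c x p}, ⟨⟨p, rfl⟩, fun x hx => h p x (c.symm hx) hp⟩, c.refl p⟩
    · rintro ⟨u, hu, hp⟩
      exact hu.2 hp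

namespace Rainbow

/-- The equivalence relation on `Ω × Ω` whose classes are the basis relations. -/
def setoid {Ω : Type*} [Finite Ω] (X : Rainbow Ω) : Setoid (Ω × Ω) :=
  Setoid.mkClasses X.basis X.isPartition.2

theorem classes_setoid {Ω : Type*} [Finite Ω] (X : Rainbow Ω) : X.setoid.classes = X.basis :=
  Setoid.classes_mkClasses X.basis X.isPartition

theorem mem_unions {Ω : Type*} [Finite Ω] (X : Rainbow Ω) (r : Set (Ω × Ω)) :
    r ∈ unions X.basis ↔ ∀ p p', X.setoid p p' → p ∈ r → p' ∈ r := by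
  rw [← classes_setoid, mem_unions_classes]

end Rainbow

namespace CoherentConfiguration

/-- Builds a coherent configuration from the equivalence relation on `Ω × Ω` whose classes are
the basis relations. -/
def ofSetoid {Ω : Type*} [Finite Ω] (c : Setoid (Ω × Ω))
    (hdiag : ∀ α p, c (α, α) p → p.1 = p.2)
    (hconv : ∀ p p', c p p' → c p.swap p'.swap)
    (hcoh : ∀ r ∈ c.classes, ∀ s ∈ c.classes, ∀ p p', c p p' →
      (nbhd p.1 r ∩ nbhd p.2 (conv s)).ncard = (nbhd p'.1 r ∩ nbhd p'.2 (conv s)).ncard) :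
    CoherentConfiguration Ω where
  basis := c.classes
  isPartition := c.isPartition_classes
  diagonal_mem := by
    rw [mem_unions_classes]
    rintro ⟨a, b⟩ p' h hab
    obtain rfl : a = b := hab
    exact hdiag a p' h
  conv_basis := by
    have key : ∀ q : Ω × Ω, conv {x | c x q} = {x | c x q.swap} := by
      intro q
      ext x
      exact ⟨fun h => hconv x.swap q h, fun h => hconv x q.swap h⟩
    ext r
    constructor
    · rintro ⟨_, ⟨q, rfl⟩, rfl⟩
      exact ⟨q.swap, key q⟩
    · rintro ⟨q, rfl⟩
      exact ⟨_, ⟨q.swap, rfl⟩, key q.swap⟩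
  coherent := by
    rintro r hr s hs t ⟨q, rfl⟩ p hp p' hp'
    exact hcoh r hr s hs p p' (c.trans hp (c.symm hp'))

/-- `X ≤ Y` if every relation of `X` is a relation of `Y`. -/
instance {Ω : Type*} [Finite Ω] : PartialOrder (CoherentConfiguration Ω) where
  le X Y := unions X.basis ⊆ unions Y.basis
  le_refl _ := subset_rfl
  le_trans _ _ _ h h' := subset_trans h h'
  le_antisymm X Y h h' := by
    have key : ∀ X Y : CoherentConfiguration Ω, unions X.basis ⊆ unions Y.basis →
        ∀ p p', Y.setoid p p' → X.setoid p p' := by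
      intro X Y h p p' hp
      have h1 : {x | X.setoid x p} ∈ unions X.basis := by
        rw [X.mem_unions]
        intro a b hab ha
        exact X.setoid.trans (X.setoid.symm hab) ha
      have h2 := (Y.mem_unions _).1 (h h1) p p' hp (X.setoid.refl p)
      exact X.setoid.symm h2
    have hs : X.setoid = Y.setoid :=
      Setoid.ext fun p p' => ⟨key Y X h' p p', key X Y h p p'⟩
    have hb : X.basis = Y.basis := by
      rw [← X.classes_setoid, ← Y.classes_setoid, hs]
    obtain ⟨⟨b, _, _, _⟩, _⟩ := X
    obtain ⟨⟨b', _, _, _⟩, _⟩ := Y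
    obtain rfl : b = b' := hb
    rfl

/-- The coherent configuration `Inv(G)` of a permutation group `G`: its basis relations are the
orbits of `G` on `Ω × Ω`. -/
def inv {Ω : Type*} [Finite Ω] (G : Subgroup (Equiv.Perm Ω)) : CoherentConfiguration Ω where
  basis := Set.range fun p : Ω × Ω => MulAction.orbit G p
  isPartition := by
    have h : Set.range (fun p : Ω × Ω => MulAction.orbit G p)
        = (MulAction.orbitRel G (Ω × Ω)).classes := by
      ext r
      exact ⟨fun ⟨p, hp⟩ => ⟨p, hp.symm⟩, fun ⟨p, hp⟩ => ⟨p, hp.symm⟩⟩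
    rw [h]
    exact Setoid.isPartition_classes _
  diagonal_mem := by
    refine ⟨{u | ∃ α : Ω, u = MulAction.orbit G (α, α)}, ?_, ?_⟩
    · rintro _ ⟨α, rfl⟩
      exact ⟨_, rfl⟩
    · ext ⟨a, b⟩
      constructor
      · intro h
        obtain rfl : a = b := h
        exact ⟨_, ⟨a, rfl⟩, MulAction.mem_orbit_self _⟩
      · rintro ⟨_, ⟨α, rfl⟩, ⟨g, hg⟩⟩
        have h1 : g • α = a := congrArg Prod.fst hg
        have h2 : g • α = b := congrArg Prod.snd hg
        exact h1.symm.trans h2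
  conv_basis := by
    have key : ∀ q : Ω × Ω, conv (MulAction.orbit G q) = MulAction.orbit G q.swap := by
      intro q
      ext x
      constructor
      · rintro ⟨g, hg⟩
        exact ⟨g, Prod.ext (congrArg Prod.snd hg) (congrArg Prod.fst hg)⟩
      · rintro ⟨g, hg⟩
        exact ⟨g, Prod.ext (congrArg Prod.snd hg) (congrArg Prod.fst hg)⟩
    ext r
    constructor
    · rintro ⟨_, ⟨q, rfl⟩, rfl⟩
      exact ⟨q.swap, (key q).symm⟩
    · rintro ⟨q, rfl⟩
      exact ⟨_, ⟨q.swap, rfl⟩, key q.swap⟩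
  coherent := by
    have step : ∀ (u v x : Ω × Ω) (g : G),
        (nbhd x.1 (MulAction.orbit G u) ∩ nbhd x.2 (conv (MulAction.orbit G v))).ncard
          ≤ (nbhd (g • x).1 (MulAction.orbit G u)
            ∩ nbhd (g • x).2 (conv (MulAction.orbit G v))).ncard := by
      intro u v x g
      refine Set.ncard_le_ncard_of_injOn (fun γ => g • γ) ?_
        (fun a _ b _ h => MulAction.injective g h) (Set.toFinite _)
      rintro γ ⟨h1, h2⟩
      exact ⟨(MulAction.mem_orbit_of_mem_orbit g h1 : g • (x.1, γ) ∈ _),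
        (MulAction.mem_orbit_of_mem_orbit g h2 : g • (γ, x.2) ∈ _)⟩
    rintro _ ⟨u, rfl⟩ _ ⟨v, rfl⟩ _ ⟨w, rfl⟩ p hp p' hp'
    obtain ⟨g, rfl⟩ := hp
    obtain ⟨g', rfl⟩ := hp'
    apply le_antisymm
    · simpa [smul_smul] using step u v (g • w) (g' * g⁻¹)
    · simpa [smul_smul] using step u v (g' • w) (g * g'⁻¹)

/-- The equivalence relation on `Ω × Ω` generated by the equivalence relations of all coherent
configurations that have all members of `T` among their relations. -/
def wlSetoid {Ω : Type*} [Finite Ω] (T : Set (Set (Ω × Ω))) : Setoid (Ω × Ω) :=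
  sSup {c | ∃ Y : CoherentConfiguration Ω, T ⊆ unions Y.basis ∧ c = Y.setoid}

theorem wlSetoid_le_iff {Ω : Type*} [Finite Ω] (T : Set (Set (Ω × Ω))) (d : Setoid (Ω × Ω)) :
    wlSetoid T ≤ d ↔
      ∀ Y : CoherentConfiguration Ω, T ⊆ unions Y.basis → Y.setoid ≤ d := by
  refine sSup_le_iff.trans ⟨fun h Y hY => h _ ⟨Y, hY, rfl⟩, ?_⟩
  rintro h _ ⟨Y, hY, rfl⟩
  exact h Y hY

theorem setoid_le_wlSetoid {Ω : Type*} [Finite Ω] (T : Set (Set (Ω × Ω)))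
    (Y : CoherentConfiguration Ω) (hY : T ⊆ unions Y.basis) : Y.setoid ≤ wlSetoid T :=
  (wlSetoid_le_iff T _).1 le_rfl Y hY

theorem setoid_swap {Ω : Type*} [Finite Ω] (Y : CoherentConfiguration Ω) (p p' : Ω × Ω)
    (h : Y.setoid p p') : Y.setoid p.swap p'.swap := by
  have h1 : {x | Y.setoid x p} ∈ Y.basis := by
    rw [← Y.classes_setoid]
    exact ⟨p, rfl⟩
  have h2 : conv {x | Y.setoid x p} ∈ Y.basis := by
    rw [← Y.conv_basis]
    exact ⟨_, h1, rfl⟩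
  rw [← Y.classes_setoid] at h2
  obtain ⟨z, hz⟩ := h2
  have h3 : p.swap ∈ conv {x | Y.setoid x p} := Y.setoid.refl p
  have h4 : p'.swap ∈ conv {x | Y.setoid x p} := Y.setoid.symm h
  rw [hz] at h3 h4
  exact Y.setoid.trans h3 (Y.setoid.symm h4)

/-- In a coherent configuration `|α r ∩ β s*|` is constant on basis relations also for arbitrary
relations `r` and `s`. -/
theorem coherent_unions {Ω : Type*} [Finite Ω] (Y : CoherentConfiguration Ω)
    (r s : Set (Ω × Ω)) (hr : r ∈ unions Y.basis) (hs : s ∈ unions Y.basis) (p p' : Ω × Ω)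
    (h : Y.setoid p p') :
    (nbhd p.1 r ∩ nbhd p.2 (conv s)).ncard = (nbhd p'.1 r ∩ nbhd p'.2 (conv s)).ncard := by
  classical
  have cls : ∀ q, {x | Y.setoid x q} ∈ Y.basis := fun q => by
    rw [← Y.classes_setoid]
    exact ⟨q, rfl⟩
  have := Fintype.ofFinite Ω
  let col : Ω × Ω → Ω → Quotient Y.setoid × Quotient Y.setoid :=
    fun x γ => (Quotient.mk Y.setoid (x.1, γ), Quotient.mk Y.setoid (γ, x.2))
  have := Fintype.ofFinite (Quotient Y.setoid)
  have fib : ∀ k, (Finset.univ.filter fun γ => col p γ = k).card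
      = (Finset.univ.filter fun γ => col p' γ = k).card := by
    rintro ⟨a, b⟩
    obtain ⟨u, rfl⟩ := Quotient.exists_rep a
    obtain ⟨v, rfl⟩ := Quotient.exists_rep b
    have e := Y.coherent _ (cls u) _ (cls v) _ (cls p) p (Y.setoid.refl p) p' (Y.setoid.symm h)
    have conv' : ∀ x : Ω × Ω, (nbhd x.1 {y | Y.setoid y u} ∩
        nbhd x.2 (conv {y | Y.setoid y v})).ncard
        = (Finset.univ.filter fun γ => col x γ = (⟦u⟧, ⟦v⟧)).card := by
      intro x
      rw [← Set.ncard_coe_finset]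
      congr 1
      ext γ
      simp only [Finset.coe_filter, Finset.mem_univ, true_and, Set.mem_ofPred_eq, col,
        Prod.mk.injEq, Quotient.eq]
      rfl
    rw [conv', conv'] at e
    exact e
  have tot : ∀ x : Ω × Ω, (nbhd x.1 r ∩ nbhd x.2 (conv s)).ncard
      = ∑ k : Quotient Y.setoid × Quotient Y.setoid,
        if k.1.out ∈ r ∧ k.2.out ∈ s then (Finset.univ.filter fun γ => col x γ = k).card
        else 0 := by
    intro x
    have m : ∀ w ∈ unions Y.basis, ∀ y, (Quotient.mk Y.setoid y).out ∈ w ↔ y ∈ w := by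
      intro w hw y
      have hy : Y.setoid (Quotient.mk Y.setoid y).out y := Quotient.mk_out y
      exact ⟨(Y.mem_unions w).1 hw _ _ hy, (Y.mem_unions w).1 hw _ _ (Y.setoid.symm hy)⟩
    have e : nbhd x.1 r ∩ nbhd x.2 (conv s)
        = ((Finset.univ.filter fun γ => (x.1, γ) ∈ r ∧ (γ, x.2) ∈ s : Finset Ω) : Set Ω) := by
      ext γ
      simp [nbhd, conv]
    rw [e, Set.ncard_coe_finset,
      Finset.card_eq_sum_card_fiberwise (f := col x) (t := Finset.univ) (by simp)]
    refine Finset.sum_congr rfl fun k _ => ?_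
    split_ifs with hk
    · congr 1
      ext γ
      simp only [Finset.mem_filter, Finset.mem_univ, true_and]
      refine ⟨fun h => h.2, fun h => ⟨?_, h⟩⟩
      subst h
      exact ⟨(m r hr _).1 hk.1, (m s hs _).1 hk.2⟩
    · rw [Finset.card_eq_zero, Finset.filter_eq_empty_iff]
      rintro γ hγ rfl
      simp only [Finset.mem_filter, Finset.mem_univ, true_and] at hγ
      exact hk ⟨(m r hr _).2 hγ.1, (m s hs _).2 hγ.2⟩
  rw [tot, tot]
  exact Finset.sum_congr rfl fun k _ => by rw [fib k]

/-- The coherent closure `WL(T)` of a set `T` of relations: the smallest coherent configuration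
for which all members of `T` are relations (see `isLeast_WL`). -/
def WL {Ω : Type*} [Finite Ω] (T : Set (Set (Ω × Ω))) : CoherentConfiguration Ω :=
  ofSetoid (wlSetoid T)
    (by
      let d : Setoid (Ω × Ω) :=
        ⟨fun p p' => (p.1 = p.2 ↔ p'.1 = p'.2), fun _ => Iff.rfl, fun h => h.symm,
          fun h h' => h.trans h'⟩
      have hd : wlSetoid T ≤ d := by
        rw [wlSetoid_le_iff]
        intro Y _ p p' h
        have hm := (Y.mem_unions _).1 Y.diagonal_mem
        exact ⟨fun hp => hm p p' h hp, fun hp => hm p' p (Y.setoid.symm h) hp⟩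
      intro α p h
      exact (hd h).1 rfl)
    (by
      have hd : wlSetoid T ≤ (wlSetoid T).comap Prod.swap := by
        rw [wlSetoid_le_iff]
        intro Y hY p p' h
        exact setoid_le_wlSetoid T Y hY (setoid_swap Y p p' h)
      intro p p' h
      exact hd h)
    (by
      intro r hr s hs p p' h
      have hu : ∀ w ∈ (wlSetoid T).classes, ∀ Y : CoherentConfiguration Ω,
          T ⊆ unions Y.basis → w ∈ unions Y.basis := by
        rintro _ ⟨q, rfl⟩ Y hY
        rw [Y.mem_unions]
        intro a b hab ha
        exact (wlSetoid T).trans ((wlSetoid T).symm (setoid_le_wlSetoid T Y hY hab)) ha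
      have hd : wlSetoid T ≤ Setoid.ker
          (fun p : Ω × Ω => (nbhd p.1 r ∩ nbhd p.2 (conv s)).ncard) := by
        rw [wlSetoid_le_iff]
        intro Y hY a b hab
        exact coherent_unions Y r s (hu r hr Y hY) (hu s hs Y hY) a b hab
      exact hd h)

theorem isLeast_WL {Ω : Type*} [Finite Ω] (T : Set (Set (Ω × Ω))) :
    IsLeast {Y : CoherentConfiguration Ω | T ⊆ unions Y.basis} (WL T) := by
  constructor
  · intro t ht
    change t ∈ unions (wlSetoid T).classes
    rw [mem_unions_classes]
    let d : Setoid (Ω × Ω) :=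
      ⟨fun p p' => (p ∈ t ↔ p' ∈ t), fun _ => Iff.rfl, fun h => h.symm, fun h h' => h.trans h'⟩
    have hd : wlSetoid T ≤ d := by
      rw [wlSetoid_le_iff]
      intro Y hY p p' h
      have hm := (Y.mem_unions _).1 (hY ht)
      exact ⟨hm p p' h, hm p' p (Y.setoid.symm h)⟩
    intro p p' h
    exact (hd h).1
  · intro Y hY w hw
    have hw' : w ∈ unions (wlSetoid T).classes := hw
    rw [mem_unions_classes] at hw'
    rw [Y.mem_unions]
    intro p p' h
    exact hw' p p' (setoid_le_wlSetoid T Y hY h)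

/-- The point extension of `X` with respect to the points of `A`: the coherent closure of the
basis relations of `X` together with the relations `1_α = {(α, α)}`, `α ∈ A`. -/
def pointExtension {Ω : Type*} [Finite Ω] (X : CoherentConfiguration Ω) (A : Set Ω) :
    CoherentConfiguration Ω :=
  WL (X.basis ∪ {r | ∃ α ∈ A, r = {(α, α)}})

/-- Partly regular: some point `α` satisfies `|α s| ≤ 1` for all basis relations `s`. -/
def IsPartlyRegular {Ω : Type*} [Finite Ω] (X : CoherentConfiguration Ω) : Prop :=
  ∃ α : Ω, ∀ s ∈ X.basis, (nbhd α s).ncard ≤ 1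

end CoherentConfiguration

/-- A monomial matrix: exactly one nonzero entry in each row and in each column. -/
def IsMonomial {ι F : Type*} [Zero F] (A : Matrix ι ι F) : Prop :=
  (∀ i, ∃! j, A i j ≠ 0) ∧ (∀ j, ∃! i, A i j ≠ 0)

theorem isMonomial_two_iff {F : Type*} [Zero F] (A : Matrix (Fin 2) (Fin 2) F) :
    IsMonomial A ↔ (A 0 1 = 0 ∧ A 1 0 = 0 ∧ A 0 0 ≠ 0 ∧ A 1 1 ≠ 0) ∨
      (A 0 0 = 0 ∧ A 1 1 = 0 ∧ A 0 1 ≠ 0 ∧ A 1 0 ≠ 0) := by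
  simp only [IsMonomial, ExistsUnique, Fin.forall_fin_two, Fin.exists_fin_two]
  by_cases h1 : A 0 0 = 0 <;> by_cases h2 : A 0 1 = 0 <;> by_cases h3 : A 1 0 = 0 <;>
    by_cases h4 : A 1 1 = 0 <;> simp [h1, h2, h3, h4]

/-- The group of permutations `v ↦ A v + b` of `F²`, where `A` runs over the monomial matrices of
determinant `±1` and `b` over all vectors. -/
def passmanGroup (F : Type*) [Field F] : Subgroup (Equiv.Perm (Fin 2 → F)) where
  carrier := {g | ∃ (A : Matrix (Fin 2) (Fin 2) F) (b : Fin 2 → F),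
    IsMonomial A ∧ (A.det = 1 ∨ A.det = -1) ∧ ∀ v, g v = A.mulVec v + b}
  one_mem' := by
    refine ⟨1, 0, ?_, Or.inl Matrix.det_one, fun v => by simp⟩
    rw [isMonomial_two_iff]
    simp
  mul_mem' := by
    rintro g h ⟨A, b, hA, hdA, hg⟩ ⟨B, c, hB, hdB, hh⟩
    refine ⟨A * B, A.mulVec c + b, ?_, ?_, fun v => ?_⟩
    · rw [isMonomial_two_iff] at *
      simp only [Matrix.mul_apply, Fin.sum_univ_two]
      rcases hA with ⟨a1, a2, a3, a4⟩ | ⟨a1, a2, a3, a4⟩ <;>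
        rcases hB with ⟨b1, b2, b3, b4⟩ | ⟨b1, b2, b3, b4⟩ <;>
        simp [a1, a2, a3, a4, b1, b2, b3, b4]
    · rw [Matrix.det_mul]
      rcases hdA with h1 | h1 <;> rcases hdB with h2 | h2 <;> simp [h1, h2]
    · rw [Equiv.Perm.mul_apply, hh, hg, Matrix.mulVec_add, Matrix.mulVec_mulVec, add_assoc]
  inv_mem' := by
    rintro g ⟨A, b, hA, hdA, hg⟩
    have hu : IsUnit A.det := by
      rcases hdA with h1 | h1 <;> simp [h1]
    have hinv : A⁻¹ = A.det⁻¹ • !![A 1 1, -A 0 1; -A 1 0, A 0 0] := by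
      rw [Matrix.inv_def, Matrix.adjugate_fin_two, Ring.inverse_eq_inv']
    have hne : A.det ≠ 0 := hu.ne_zero
    refine ⟨A⁻¹, -(A⁻¹.mulVec b), ?_, ?_, fun v => ?_⟩
    · rw [isMonomial_two_iff] at *
      rw [hinv]
      rcases hA with ⟨a1, a2, a3, a4⟩ | ⟨a1, a2, a3, a4⟩ <;> simp [a1, a2, a3, a4, hne]
    · rw [Matrix.det_nonsing_inv, Ring.inverse_eq_inv']
      rcases hdA with h1 | h1
      · simp [h1]
      · right
        rw [h1]
        norm_num
    · rw [Equiv.Perm.inv_eq_iff_eq, hg, Matrix.mulVec_add, Matrix.mulVec_neg,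
        Matrix.mulVec_mulVec, Matrix.mulVec_mulVec, Matrix.mul_nonsing_inv A hu]
      simp

/-- The Passman scheme of degree `|F|²`. -/
def passmanScheme (F : Type*) [Field F] [Finite F] : CoherentConfiguration (Fin 2 → F) :=
  CoherentConfiguration.inv (passmanGroup F)

/-!
From a fixed point `u`, call a point determined if it is alone in its basis relation from `u`.
Basis relations between determined points and further points can be read off from `u`, so two
points which some invariant of the configuration tells apart by their values at the determined
points lie in different basis relations from `u`.

For the Passman scheme an invariant is the squared area of the axis-parallel rectangle spanned by
two points, since monomial matrices of determinant `±1` preserve this area up to sign. Choose `u`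
such that it forms three corners of an axis-parallel rectangle with two of the given points. Then
the fourth corner is determined, hence the lines through the sides of the rectangle, hence all
points.
-/

/-- The set `D` contains every point which the values `f δ ·`, `δ ∈ D`, separate from all other
points outside `D`. The term is modelled on the resolving sets of a graph, where `f` is the
distance. -/
def IsResolvingClosed {Ω T : Type*} (f : Ω → Ω → T) (D : Set Ω) : Prop :=
  ∀ v, (∀ w ∉ D, (∀ δ ∈ D, f δ w = f δ v) → w = v) → v ∈ D

theorem IsResolvingClosed.preimage {Ω Ω' T : Type*} {f : Ω → Ω → T} {D : Set Ω}
    (hD : IsResolvingClosed f D) (e : Ω' ≃ Ω) :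
    IsResolvingClosed (fun u v => f (e u) (e v)) (e ⁻¹' D) := by
  refine fun v hv => hD (e v) fun w hw hwv => ?_
  rw [← e.symm_apply_eq]
  exact hv _ (by simpa using hw) fun δ hδ => by simpa using hwv (e δ) hδ

namespace Rainbow

variable {Ω : Type*} [Finite Ω]

theorem setOf_setoid_mem_basis (X : Rainbow Ω) (p : Ω × Ω) : {x | X.setoid x p} ∈ X.basis := by
  rw [← X.classes_setoid]
  exact ⟨p, rfl⟩

theorem setoid_le_of_basis_subset {X Y : Rainbow Ω} (h : X.basis ⊆ unions Y.basis) :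
    Y.setoid ≤ X.setoid := fun {p p'} hp =>
  X.setoid.symm <|
    (Y.mem_unions _).1 (h (X.setOf_setoid_mem_basis p)) p p' hp (X.setoid.refl p)

end Rainbow

namespace CoherentConfiguration

variable {Ω : Type*} [Finite Ω]

theorem setoid_inv (G : Subgroup (Equiv.Perm Ω)) :
    (inv G).setoid = MulAction.orbitRel G (Ω × Ω) := by
  refine Setoid.classes_inj.2 ?_
  rw [Rainbow.classes_setoid]
  ext r
  exact exists_congr fun p => eq_comm

theorem exists_setoid_and_setoid (Y : CoherentConfiguration Ω) {α β α' β' : Ω}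
    (h : Y.setoid (α, β) (α', β')) (γ : Ω) :
    ∃ γ', Y.setoid (α, γ) (α', γ') ∧ Y.setoid (γ, β) (γ', β') := by
  let r := {x | Y.setoid x (α, γ)}
  let s := {x | Y.setoid x (γ, β)}
  have hcard : (nbhd α r ∩ nbhd β (conv s)).ncard = (nbhd α' r ∩ nbhd β' (conv s)).ncard :=
    Y.coherent r (Y.setOf_setoid_mem_basis _) s (Y.setOf_setoid_mem_basis _) _
      (Y.setOf_setoid_mem_basis (α, β)) _ (Y.setoid.refl _) _ (Y.setoid.symm h)
  have hγ : (nbhd α r ∩ nbhd β (conv s)).Nonempty := ⟨γ, Y.setoid.refl _, Y.setoid.refl _⟩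
  rw [← Set.ncard_pos, hcard, Set.ncard_pos] at hγ
  obtain ⟨γ', hr, hs⟩ := hγ
  exact ⟨γ', Y.setoid.symm hr, Y.setoid.symm hs⟩

/-- The points that are determined by `α`: those points `β` that are alone in their basis
relation from `α`. Partial regularity at `α` means that `α` determines all points. -/
def determined (Y : CoherentConfiguration Ω) (α : Ω) : Set Ω :=
  {β | ∀ γ, Y.setoid (α, β) (α, γ) → γ = β}

theorem mem_determined_self (Y : CoherentConfiguration Ω) (α : Ω) : α ∈ Y.determined α :=
  fun γ h => ((Y.mem_unions _).1 Y.diagonal_mem _ (α, γ) h rfl).symm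

theorem mem_determined_of_singleton_mem_unions {Y : CoherentConfiguration Ω} {β : Ω}
    (hβ : {(β, β)} ∈ unions Y.basis) (α : Ω) : β ∈ Y.determined α := by
  intro γ h
  obtain ⟨δ, -, hδ⟩ := Y.exists_setoid_and_setoid h β
  exact congrArg Prod.snd ((Y.mem_unions _).1 hβ _ (δ, γ) hδ rfl)

theorem setoid_of_mem_determined {Y : CoherentConfiguration Ω} {α β γ δ : Ω}
    (hδ : δ ∈ Y.determined α) (h : Y.setoid (α, β) (α, γ)) : Y.setoid (δ, β) (δ, γ) := by
  obtain ⟨δ', hαδ, hδβ⟩ := Y.exists_setoid_and_setoid h δ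
  rwa [hδ δ' hαδ] at hδβ

theorem isResolvingClosed_determined {T : Type*} {Y : CoherentConfiguration Ω} {f : Ω → Ω → T}
    (hf : Y.setoid ≤ Setoid.ker (Function.uncurry f)) (α : Ω) :
    IsResolvingClosed f (Y.determined α) := by
  intro v hv w hvw
  by_cases hw : w ∈ Y.determined α
  · exact (hw v (Y.setoid.symm hvw)).symm
  · exact hv w hw fun δ hδ => (hf (setoid_of_mem_determined hδ hvw)).symm

theorem isPartlyRegular_of_determined_eq_univ {Y : CoherentConfiguration Ω} {α : Ω}
    (h : Y.determined α = Set.univ) : Y.IsPartlyRegular := by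
  refine ⟨α, fun s hs => ?_⟩
  rw [← Y.classes_setoid] at hs
  obtain ⟨p, rfl⟩ := hs
  refine Set.ncard_le_one_iff_subsingleton.2 fun β hβ γ hγ => ?_
  exact Set.eq_univ_iff_forall.1 h γ β (Y.setoid.trans hγ (Y.setoid.symm hβ))

theorem setoid_pointExtension_le (X : CoherentConfiguration Ω) (A : Set Ω) :
    (X.pointExtension A).setoid ≤ X.setoid :=
  Rainbow.setoid_le_of_basis_subset (Set.subset_union_left.trans (isLeast_WL _).1)

theorem subset_determined_pointExtension (X : CoherentConfiguration Ω) (A : Set Ω) (α : Ω) :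
    A ⊆ (X.pointExtension A).determined α := fun β hβ =>
  mem_determined_of_singleton_mem_unions ((isLeast_WL _).1 (Or.inr ⟨β, hβ, rfl⟩)) α

end CoherentConfiguration

section Plane

variable {R : Type*}

/-- The reflection `(x, y) ↦ (y, x)` of the plane. -/
def swapCoords (R : Type*) : (Fin 2 → R) ≃ (Fin 2 → R) :=
  (Equiv.swap 0 1).arrowCongr (Equiv.refl R)

theorem swapCoords_vec (a b : R) : swapCoords R ![a, b] = ![b, a] := by
  ext i
  fin_cases i <;> rfl

theorem eq_vec_iff {v : Fin 2 → R} {a b : R} : v = ![a, b] ↔ v 0 = a ∧ v 1 = b := by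
  simp [funext_iff, Fin.forall_fin_two]

theorem exists_third_corner [Nontrivial R] {α β : Fin 2 → R} (h : α ≠ β) :
    ∃ (u : Fin 2 → R) (a a' b b' : R), a ≠ a' ∧ b ≠ b' ∧
      ({![a, b], ![a', b], ![a, b']} : Set (Fin 2 → R)) ⊆ {α, β, u} := by
  have eta (v : Fin 2 → R) : v = ![v 0, v 1] := eq_vec_iff.2 ⟨rfl, rfl⟩
  by_cases h₀ : α 0 = β 0
  · have h₁ : α 1 ≠ β 1 := fun h₁ => h (funext (Fin.forall_fin_two.2 ⟨h₀, h₁⟩))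
    obtain ⟨c, hc⟩ := exists_ne (α 0)
    refine ⟨![c, α 1], α 0, c, α 1, β 1, hc.symm, h₁, ?_⟩
    rw [← eta α, h₀, ← eta β]
    grind
  by_cases h₁ : α 1 = β 1
  · obtain ⟨c, hc⟩ := exists_ne (α 1)
    refine ⟨![α 0, c], α 0, β 0, α 1, c, h₀, hc.symm, ?_⟩
    rw [← eta α, h₁, ← eta β]
  · refine ⟨![β 0, α 1], β 0, α 0, α 1, β 1, Ne.symm h₀, h₁, ?_⟩
    rw [← eta α, ← eta β]
    grind

end Plane

section Rectangle

variable {R : Type*} [CommRing R]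

/-- The squared area of the axis-parallel rectangle with opposite corners `u` and `v`. -/
def sqArea (u v : Fin 2 → R) : R := ((u 0 - v 0) * (u 1 - v 1)) ^ 2

theorem sqArea_swapCoords (u v : Fin 2 → R) :
    sqArea (swapCoords R u) (swapCoords R v) = sqArea u v :=
  congrArg (· ^ 2) (mul_comm (u 1 - v 1) (u 0 - v 0))

theorem IsResolvingClosed.preimage_swapCoords {D : Set (Fin 2 → R)}
    (hD : IsResolvingClosed sqArea D) : IsResolvingClosed sqArea (swapCoords R ⁻¹' D) := by
  simpa only [sqArea_swapCoords] using hD.preimage (swapCoords R)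

variable [NoZeroDivisors R]

theorem sqArea_eq_zero {u v : Fin 2 → R} : sqArea u v = 0 ↔ v 0 = u 0 ∨ v 1 = u 1 := by
  rw [sqArea, sq_eq_zero_iff, mul_eq_zero, sub_eq_zero, sub_eq_zero, eq_comm, @eq_comm _ (u 1)]

theorem eq_of_sq_sub_eq {a a' x y : R} (ha : a ≠ a') (h : (a - y) ^ 2 = (a - x) ^ 2)
    (h' : (a' - y) ^ 2 = (a' - x) ^ 2) : y = x := by
  -- There is no factor `2` on the left, so the identity also serves in characteristic `2`.
  have hprod : (y - x) ^ 2 * (a - a') = 0 := by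
    linear_combination (x - a') * h - (x - a) * h'
  exact sub_eq_zero.1 (sq_eq_zero_iff.1 ((mul_eq_zero.1 hprod).resolve_right (sub_ne_zero.2 ha)))

namespace IsResolvingClosed

variable {D : Set (Fin 2 → R)} {a a' b b' : R}

theorem fourth_corner_mem (hD : IsResolvingClosed sqArea D) (ha : a ≠ a') (hb : b ≠ b')
    (hab : ![a, b] ∈ D) (hab₁ : ![a', b] ∈ D) (hab₂ : ![a, b'] ∈ D) : ![a', b'] ∈ D := by
  refine hD _ fun w hw harea => ?_
  have hw₁ : w 0 = a' ∨ w 1 = b :=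
    sqArea_eq_zero.1 ((harea _ hab₁).trans (sqArea_eq_zero.2 (Or.inl rfl)))
  have hw₂ : w 0 = a ∨ w 1 = b' :=
    sqArea_eq_zero.1 ((harea _ hab₂).trans (sqArea_eq_zero.2 (Or.inr rfl)))
  have hw₀ : ¬(w 0 = a ∧ w 1 = b) := fun h => hw (eq_vec_iff.2 h ▸ hab)
  rw [eq_vec_iff]
  grind

theorem horizontal_line_mem (hD : IsResolvingClosed sqArea D) (ha : a ≠ a') (hb : b ≠ b')
    (h₁ : ![a, b] ∈ D) (h₂ : ![a', b] ∈ D) (h₃ : ![a, b'] ∈ D) (h₄ : ![a', b'] ∈ D) (x : R) :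
    ![x, b] ∈ D := by
  refine hD _ fun w _ harea => ?_
  have hw₁ : w 1 = b := by
    have hwa : w 0 = a ∨ w 1 = b :=
      sqArea_eq_zero.1 ((harea _ h₁).trans (sqArea_eq_zero.2 (Or.inr rfl)))
    have hwa' : w 0 = a' ∨ w 1 = b :=
      sqArea_eq_zero.1 ((harea _ h₂).trans (sqArea_eq_zero.2 (Or.inr rfl)))
    grind
  have hsq : ∀ c, ![c, b'] ∈ D → (c - w 0) ^ 2 = (c - x) ^ 2 := by
    intro c hc
    have hbb : (b' - b) ^ 2 ≠ 0 := pow_ne_zero _ (sub_ne_zero.2 hb.symm)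
    have h := harea _ hc
    simp only [sqArea, mul_pow, hw₁, Matrix.cons_val_zero, Matrix.cons_val_one] at h
    exact mul_right_cancel₀ hbb h
  exact eq_vec_iff.2 ⟨eq_of_sq_sub_eq ha (hsq a h₃) (hsq a' h₄), hw₁⟩

theorem eq_univ_of_lines_mem (hD : IsResolvingClosed sqArea D) (hhor : ∀ x, ![x, b] ∈ D)
    (hver : ∀ y, ![a, y] ∈ D) : D = Set.univ := by
  refine Set.eq_univ_of_forall fun v => hD v fun w hw harea => ?_
  have hwb : w 1 ≠ b := fun h => hw (eq_vec_iff.2 ⟨rfl, h⟩ ▸ hhor (w 0))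
  have hwa : w 0 ≠ a := fun h => hw (eq_vec_iff.2 ⟨h, rfl⟩ ▸ hver (w 1))
  have hw₀ : w 0 = v 0 ∨ w 1 = b :=
    sqArea_eq_zero.1 ((harea _ (hhor (v 0))).trans (sqArea_eq_zero.2 (Or.inl rfl)))
  have hw₁ : w 0 = a ∨ w 1 = v 1 :=
    sqArea_eq_zero.1 ((harea _ (hver (v 1))).trans (sqArea_eq_zero.2 (Or.inr rfl)))
  exact funext (Fin.forall_fin_two.2 ⟨hw₀.resolve_right hwb, hw₁.resolve_left hwa⟩)

theorem eq_univ_of_three_corners_mem (hD : IsResolvingClosed sqArea D) (ha : a ≠ a')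
    (hb : b ≠ b') (h : {![a, b], ![a', b], ![a, b']} ⊆ D) : D = Set.univ := by
  obtain ⟨h₁, h₂, h₃⟩ : ![a, b] ∈ D ∧ ![a', b] ∈ D ∧ ![a, b'] ∈ D := by
    simpa only [Set.insert_subset_iff, Set.singleton_subset_iff] using h
  have h₄ : ![a', b'] ∈ D := hD.fourth_corner_mem ha hb h₁ h₂ h₃
  refine hD.eq_univ_of_lines_mem (a := a) (hD.horizontal_line_mem ha hb h₁ h₂ h₃ h₄) fun y => ?_
  have hy : ![y, a] ∈ swapCoords R ⁻¹' D := by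
    apply hD.preimage_swapCoords.horizontal_line_mem hb ha <;>
      rwa [Set.mem_preimage, swapCoords_vec]
  rwa [Set.mem_preimage, swapCoords_vec] at hy

end IsResolvingClosed

end Rectangle

section Passman

variable {F : Type*} [Field F]

theorem sqArea_passmanGroup_smul (g : passmanGroup F) (u v : Fin 2 → F) :
    sqArea (g • u) (g • v) = sqArea u v := by
  obtain ⟨g, A, b, hA, hdet, hg⟩ := g
  have hdet_sq : A.det ^ 2 = 1 := sq_eq_one_iff.2 hdet
  change sqArea (g u) (g v) = sqArea u v
  rw [Matrix.det_fin_two] at hdet_sq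
  simp only [sqArea, hg, Matrix.mulVec, dotProduct, Fin.sum_univ_two, Pi.add_apply]
  rcases (isMonomial_two_iff A).1 hA with ⟨h01, h10, -, -⟩ | ⟨h00, h11, -, -⟩
  · rw [h01, h10] at hdet_sq ⊢
    linear_combination ((u 0 - v 0) * (u 1 - v 1)) ^ 2 * hdet_sq
  · rw [h00, h11] at hdet_sq ⊢
    linear_combination ((u 0 - v 0) * (u 1 - v 1)) ^ 2 * hdet_sq

theorem setoid_passmanScheme_le_ker_sqArea [Finite F] :
    (passmanScheme F).setoid ≤ Setoid.ker (Function.uncurry sqArea) := by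
  rw [passmanScheme, CoherentConfiguration.setoid_inv]
  rintro _ ⟨u, v⟩ ⟨g, rfl⟩
  exact sqArea_passmanGroup_smul g u v

end Passman

theorem theorem5p5_general (F : Type*) [Field F] [Finite F] {A : Set (Fin 2 → F)}
    (hA : A.Nontrivial) : ((passmanScheme F).pointExtension A).IsPartlyRegular := by
  obtain ⟨α, hα, β, hβ, hne⟩ := hA
  obtain ⟨u, a, a', b, b', ha, hb, hcorners⟩ := exists_third_corner hne
  let D := ((passmanScheme F).pointExtension A).determined u
  have hAD : A ⊆ D := CoherentConfiguration.subset_determined_pointExtension _ A u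
  have huD : u ∈ D := CoherentConfiguration.mem_determined_self _ u
  have hD : IsResolvingClosed sqArea D :=
    CoherentConfiguration.isResolvingClosed_determined
      ((CoherentConfiguration.setoid_pointExtension_le _ A).trans
        setoid_passmanScheme_le_ker_sqArea) u
  have hsub : {α, β, u} ⊆ D :=
    Set.insert_subset (hAD hα) (Set.insert_subset (hAD hβ) (Set.singleton_subset_iff.2 huD))
  exact CoherentConfiguration.isPartlyRegular_of_determined_eq_univ
    (hD.eq_univ_of_three_corners_mem ha hb (hcorners.trans hsub))

theorem theorem5p5 (q : ℕ) (hq : IsPrimePow q) (hodd : Odd q)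
    (F : Type*) [Field F] [Finite F] (hF : Nat.card F = q)
    (A : Set (Fin 2 → F)) (hA : 2 ≤ A.ncard) :
    ((passmanScheme F).pointExtension A).IsPartlyRegular :=
  theorem5p5_general F (Set.one_lt_ncard_iff_nontrivial.1 hA)
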